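/- Let $\mathcal{O}$ be the formal local ring of a smooth germ of complex surface, let $(x,y)$ be a local coordinate system, that is, a pair of elements of $\mathcal{O}$ establishing an isomorphism of $\mathbb{C}$-algebras $\mathcal{O}\simeq\mathbb{C}[[x,y]]$, and let $L=Z(x)$. A Newton–Puiseux series is a series of the form $\psi(x^{1/n})$ with $\psi\in\mathbb{C}[[t]]$ and $n\in\mathbb{N}^*$; $\nu_x$ denotes its order, i.e. the least exponent with non-zero coefficient ($\nu_x(0)=\infty$). A semivaluation of $\mathcal{O}$ is a function $\nu:\mathcal{O}\to[0,\infty]$ such that $\nu(fg)=\nu(f)+\nu(g)$ and $\nu(f+g)\ge\min(\nu(f),\nu(g))$ for all $f,g\in\mathcal{O}$, $\nu(\lambda)=0$ for all $\lambda\in\mathbb{C}^*$, and $\nu(0)=\infty$. Let $\mathcal{V}_L$ be the set of semivaluations $\nu$ of $\mathcal{O}$ normalized relative to $L$, i.e. with $\nu(x)=1$. Let $\xi$ be a Newton–Puiseux series and $\alpha\in[0,\infty]$; if $\alpha>0$, assume that $\xi$ has zero constant term, i.e. $\nu_x(\xi)>0$. For $f\in\mathcal{O}$, set $$\nu^{\xi,\alpha}(f):=\inf\{\nu_x(f(x,\eta))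 \mid \eta \text{ a Newton–Puiseux series with } \nu_x(\eta-\xi)\ge\alpha\}\quad\text{if }\alpha>0,$$ and let $\nu^{\xi,0}(f):=\mathrm{ord}^L(f)$ be the vanishing order of $f$ along $L$, i.e. the supremum of the integers $k$ such that $x^k$ divides $f$. Then $\nu^{\xi,\alpha}\in\mathcal{V}_L$: the map $\nu^{\xi,\alpha}$ is a semivaluation of $\mathcal{O}$, and $\nu^{\xi,\alpha}(x)=1$. -/

import Mathlib

open scoped NNReal ENNReal

noncomputable section

namespace NewtonPuiseuxSemivaluation

/-- A formal local coordinate system `(x, y)`: two elements of the `ℂ`-algebra `O` together with the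
isomorphism of `ℂ`-algebras `O ≃ ℂ[[x, y]]` which they establish. -/
structure LocalCoordinates (O : Type*) [CommRing O] [Algebra ℂ O] where
  /-- the first coordinate, a defining function of the smooth branch `L = Z(x)` -/
  x : O
  /-- the second coordinate -/
  y : O
  /-- the isomorphism with the ring of formal power series in two variables -/
  iso : O ≃ₐ[ℂ] MvPowerSeries (Fin 2) ℂ
  iso_x : iso x = MvPowerSeries.X 0
  iso_y : iso y = MvPowerSeries.X 1

/-- A semivaluation of a `ℂ`-algebra, with values in `[0, ∞]`. -/
structure IsSemivaluation {O : Type*} [CommRing O] [Algebra ℂ O] (ν : O → ℝ≥0∞) : Prop where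
  map_mul : ∀ f g : O, ν (f * g) = ν f + ν g
  min_le_map_add : ∀ f g : O, min (ν f) (ν g) ≤ ν (f + g)
  map_const : ∀ c : ℂ, c ≠ 0 → ν (algebraMap ℂ O c) = 0
  map_zero : ν 0 = ⊤

/-- The set of semivaluations normalized relative to the divisor `L = Z(x)`, that is, taking the
value `1` on a defining function `x` of `L`. -/
def normalizedSemivaluations {O : Type*} [CommRing O] [Algebra ℂ O] (x : O) : Set (O → ℝ≥0∞) :=
  {ν | IsSemivaluation ν ∧ ν x = 1}

/-- Formal series in `x` with exponents in the nonnegative rationals (and well-ordered support).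
The Newton-Puiseux series form a subset of it. -/
abbrev RationalSeries : Type := HahnSeries ℚ≥0 ℂ

/-- The monomial `x ^ q`. -/
def xPow (q : ℚ≥0) : RationalSeries := HahnSeries.single q 1

/-- The Newton-Puiseux series: the series of the form `ψ(x ^ (1 / n))`, with `ψ ∈ ℂ[[t]]` and
`n` a positive integer. -/
def newtonPuiseux : Set RationalSeries :=
  {η | ∃ n : ℕ, 0 < n ∧ ∃ ψ : PowerSeries ℂ, η = PowerSeries.heval (xPow (1 / (n : ℚ≥0))) ψ}

/-- The order in `x`: the least exponent of the support, and `∞` for the zero series. -/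
def orderX (η : RationalSeries) : ℝ≥0∞ :=
  WithTop.map (fun q : ℚ≥0 => (q : ℝ≥0)) η.orderTop

/-- The substitution `f(x, η) = ∑ a_{ij} x ^ i η ^ j` of a series `η` of positive order in a formal
power series `f = ∑ a_{ij} X ^ i Y ^ j`. (The family of powers `η ^ j` is summable
because `η` has positive order; for other `η` this is a junk value.) -/
def evalSeries (f : MvPowerSeries (Fin 2) ℂ) (η : RationalSeries) : RationalSeries :=
  (HahnSeries.SummableFamily.smulFamily
    (fun p : ℕ × ℕ => MvPowerSeries.coeff (Finsupp.single 0 p.1 + Finsupp.single 1 p.2) f)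
    ((HahnSeries.SummableFamily.powers (xPow 1)).mul
      (HahnSeries.SummableFamily.powers η))).hsum

/-- The set of Newton-Puiseux series `η` with `ν_x(η - ξ) ≥ α`. -/
def closeSeries (ξ : RationalSeries) (α : ℝ≥0∞) : Set RationalSeries :=
  {η | η ∈ newtonPuiseux ∧ α ≤ orderX (η - ξ)}

/-- The vanishing order along the branch `Z(x)`: the exponent of the prime `x` in `f`. -/
def vanishingOrder {O : Type*} [CommRing O] (x f : O) : ℝ≥0∞ := (emultiplicity x f : ℕ∞)

open Classical in
/-- The map `ν^{ξ,α}`: the infimum of the orders of `f(x, η)` for `ν_x(η - ξ) ≥ α` if `α > 0`,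
and the vanishing order along `L = Z(x)` if `α = 0`. -/
def nu {O : Type*} [CommRing O] [Algebra ℂ O] (c : LocalCoordinates O) (ξ : RationalSeries)
    (α : ℝ≥0∞) (f : O) : ℝ≥0∞ :=
  if α = 0 then vanishingOrder c.x f
  else ⨅ η ∈ closeSeries ξ α, orderX (evalSeries (c.iso f) η)

end NewtonPuiseuxSemivaluation

end

/-!
For `α = 0` the map is the multiplicity of `x`, which is a prime element: `ℂ[[x, y]] / (x)` is the
domain `ℂ[[y]]` (`prime_X`).

For `α > 0` every `η` in the ball `ν_x(η - ξ) ≥ α` has positive order, so `f ↦ f(x, η)` is a ring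
homomorphism (`evalSeries_mul`) and `f ↦ ν_x(f(x, η))` is a semivaluation. An infimum of
semivaluations satisfies all the axioms except, in general, `ν(fg) ≤ ν(f) + ν(g)`. This last
inequality holds because, given `η₁` and `η₂` in the ball, a single `η` in the ball satisfies both
`ν_x(f(x, η)) ≤ ν_x(f(x, η₁))` and `ν_x(g(x, η)) ≤ ν_x(g(x, η₂))`
(`exists_mem_closeSeries_orderX_le`). If `η₁ = η₂ = ξ` take `η = ξ`. Otherwise take
`η = ξ + c x ^ β`, where `β` is the smaller of the orders of `η₁ - ξ` and `η₂ - ξ`, and `c ∈ ℂ` is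
generic. The exponent `β` is rational even when `α` is not, so `η` is a Newton–Puiseux series.

That a generic `c` works is seen on the Taylor expansion `f(x, ξ + h) = ∑ G_j h ^ j`
(`finite_setOf_lt_orderTop_eval_single`): if `h` has order at least `β` and `f(x, ξ + h)` has order
`q`, then some `G_j x ^ (j β)` has a nonzero coefficient at some `r ≤ q`, and the coefficient of
`x ^ r` in `f(x, ξ + c x ^ β)` is therefore a nonzero polynomial in `c`.

The multiplicativity of `f ↦ f(x, η)` and the Taylor expansion both reduce to the case of
polynomials: up to terms of order greater than `q`, the value `f(x, η)`
depends only on a truncation of `f` to a polynomial (`lt_orderTop_evalSeries_sub_aeval`), so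
only the Taylor expansion of a polynomial is needed.
-/

namespace NewtonPuiseuxSemivaluation

open HahnSeries

/-! ### The order of a series -/

theorem orderX_le_orderX {a b : RationalSeries} : orderX a ≤ orderX b ↔ a.orderTop ≤ b.orderTop :=
  WithTop.map_le_iff _ (by simp)

theorem orderX_mul (a b : RationalSeries) : orderX (a * b) = orderX a + orderX b := by
  unfold orderX
  rw [orderTop_mul]
  cases a.orderTop with
  | top => simp; rfl
  | coe p =>
    cases b.orderTop with
    | top => simp; rfl
    | coe q => rw [← WithTop.coe_add]; simp only [WithTop.map_coe, NNRat.cast_add]; rfl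

theorem min_orderX_le_orderX_add (a b : RationalSeries) :
    min (orderX a) (orderX b) ≤ orderX (a + b) := by
  rcases min_le_iff.1 (min_orderTop_le_orderTop_add (x := a) (y := b)) with h | h
  · exact min_le_of_left_le (orderX_le_orderX.2 h)
  · exact min_le_of_right_le (orderX_le_orderX.2 h)

theorem orderX_zero : orderX 0 = ⊤ := by
  simp [orderX]; rfl

theorem orderX_single {c : ℂ} (hc : c ≠ 0) (q : ℚ≥0) :
    orderX (single q c) = ((q : ℝ≥0) : ℝ≥0∞) := by
  rw [orderX, orderTop_single hc]; rfl

theorem orderX_pos {a : RationalSeries} : 0 < orderX a ↔ 0 < a.orderTop := by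
  have h := orderX_le_orderX (a := a) (b := 1)
  have h1 : orderX 1 = 0 := by
    rw [← single_zero_one, orderX_single one_ne_zero]; simp
  rw [h1, orderTop_one] at h
  rw [← not_le, h, not_le]

theorem lt_orderTop_iff {a : RationalSeries} {q : ℚ≥0} :
    (q : WithTop ℚ≥0) < a.orderTop ↔ ∀ r ≤ q, a.coeff r = 0 := by
  constructor
  · intro h r hr
    exact coeff_eq_zero_of_lt_orderTop (lt_of_le_of_lt (WithTop.coe_le_coe.2 hr) h)
  · intro h
    by_contra hlt
    have ha : a ≠ 0 := by rintro rfl; simp at hlt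
    obtain ⟨r, hr⟩ := WithTop.ne_top_iff_exists.1 (orderTop_ne_top.2 ha)
    rw [← hr, not_lt, WithTop.coe_le_coe] at hlt
    exact coeff_orderTop_ne hr.symm (h r hlt)

theorem lt_orderTop_add {a b : RationalSeries} {q : WithTop ℚ≥0}
    (ha : q < a.orderTop) (hb : q < b.orderTop) : q < (a + b).orderTop :=
  (lt_min ha hb).trans_le min_orderTop_le_orderTop_add

theorem le_orderTop_pow {a : RationalSeries} {ε : ℚ≥0} (h : (ε : WithTop ℚ≥0) ≤ a.orderTop)
    (n : ℕ) : ((n * ε : ℚ≥0) : WithTop ℚ≥0) ≤ (a ^ n).orderTop := by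
  induction n with
  | zero => simp
  | succ n ih =>
    rw [pow_succ, orderTop_mul]
    have : ((n + 1 : ℕ) * ε : ℚ≥0) = n * ε + ε := by push_cast; ring
    rw [this, WithTop.coe_add]
    exact add_le_add ih h

/-! ### Substitution of a series of positive order -/

theorem coeff_evalSeries (f : MvPowerSeries (Fin 2) ℂ) {η : RationalSeries}
    (hη : 0 < η.orderTop) (q : ℚ≥0) :
    (evalSeries f η).coeff q = ∑ᶠ p : ℕ × ℕ,
      MvPowerSeries.coeff (Finsupp.single 0 p.1 + Finsupp.single 1 p.2) f *
        (xPow 1 ^ p.1 * η ^ p.2).coeff q := by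
  have hx : 0 < (xPow 1).orderTop := by
    rw [xPow, orderTop_single one_ne_zero]; exact WithTop.coe_lt_coe.2 one_pos
  rw [evalSeries, SummableFamily.coeff_hsum]
  simp only [SummableFamily.smulFamily_toFun, SummableFamily.mul_toFun,
    SummableFamily.powers_of_orderTop_pos hx, SummableFamily.powers_of_orderTop_pos hη,
    HahnSeries.coeff_smul, smul_eq_mul]

theorem evalSeries_add (f g : MvPowerSeries (Fin 2) ℂ) (η : RationalSeries) :
    evalSeries (f + g) η = evalSeries f η + evalSeries g η := by
  unfold evalSeries
  rw [← SummableFamily.hsum_add]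
  congr 1
  ext1 p
  simp only [SummableFamily.smulFamily_toFun, SummableFamily.add_apply, map_add, add_smul]

theorem single_add_single_eq_iff (i j : ℕ) (m : Fin 2 →₀ ℕ) :
    Finsupp.single 0 i + Finsupp.single 1 j = m ↔ (i, j) = (m 0, m 1) := by
  rw [Finsupp.ext_iff, Fin.forall_fin_two]
  simp

/-- The `ℂ`-algebra structure that instance search finds on `RationalSeries` is induced from the one
over `PowerSeries ℂ`; its structure map is nevertheless the expected one. -/
theorem algebraMap_eq_single (c : ℂ) : algebraMap ℂ RationalSeries c = single 0 c := by
  rw [algebraMap_apply', PowerSeries.algebraMap_apply, Algebra.algebraMap_self_apply,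
    ofPowerSeries_C, C_apply]

/-- On polynomials, the substitution is the usual evaluation. -/
theorem evalSeries_coe (p : MvPolynomial (Fin 2) ℂ) {η : RationalSeries} (hη : 0 < η.orderTop) :
    evalSeries (p : MvPowerSeries (Fin 2) ℂ) η = MvPolynomial.aeval ![xPow 1, η] p := by
  induction p using MvPolynomial.induction_on' with
  | monomial m c =>
    ext q
    rw [coeff_evalSeries _ hη, finsum_eq_single _ (m 0, m 1)]
    · rw [(single_add_single_eq_iff _ _ m).2 rfl, MvPolynomial.coeff_coe,
        MvPolynomial.coeff_monomial, if_pos rfl, MvPolynomial.aeval_monomial,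
        Finsupp.prod_fintype _ _ (by simp), Fin.prod_univ_two, algebraMap_eq_single,
        coeff_single_zero_mul]
      rfl
    · rintro ⟨i, j⟩ hij
      rw [MvPolynomial.coeff_coe, MvPolynomial.coeff_monomial, if_neg, zero_mul]
      exact fun h => hij ((single_add_single_eq_iff i j m).1 h.symm)
  | add p q hp hq => rw [MvPolynomial.coe_add, evalSeries_add, hp, hq, map_add]

/-- If all the coefficients of `f` with both exponents at most `N` vanish, then `f(x, η)` has order
greater than every `q < N ε`, where `ε ≤ 1` is a lower bound of the order of `η`. -/
theorem lt_orderTop_evalSeries {f : MvPowerSeries (Fin 2) ℂ} {η : RationalSeries} {ε q : ℚ≥0}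
    {N : ℕ} (hε : 0 < ε) (hε1 : ε ≤ 1) (hη : (ε : WithTop ℚ≥0) ≤ η.orderTop) (hq : q < N * ε)
    (hf : ∀ m ≤ Finsupp.equivFunOnFinite.symm (fun _ : Fin 2 => N), MvPowerSeries.coeff m f = 0) :
    (q : WithTop ℚ≥0) < (evalSeries f η).orderTop := by
  rw [lt_orderTop_iff]
  intro r hr
  rw [coeff_evalSeries _ (lt_of_lt_of_le (WithTop.coe_lt_coe.2 hε) hη)]
  refine finsum_eq_zero_of_forall_eq_zero ?_
  rintro ⟨i, j⟩
  by_cases hij : i ≤ N ∧ j ≤ N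
  · rw [hf _ ?_, zero_mul]
    intro k
    fin_cases k <;> simp [hij]
  · refine mul_eq_zero_of_right _ (coeff_eq_zero_of_lt_orderTop ?_)
    rw [orderTop_mul]
    have hx : (ε : WithTop ℚ≥0) ≤ (xPow 1).orderTop := by
      rw [xPow, orderTop_single one_ne_zero]; exact WithTop.coe_le_coe.2 hε1
    refine lt_of_lt_of_le ?_ (add_le_add (le_orderTop_pow hx i) (le_orderTop_pow hη j))
    rw [← WithTop.coe_add, WithTop.coe_lt_coe, ← add_mul]
    refine (hr.trans_lt hq).trans_le ?_
    gcongr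
    have : N ≤ i + j := by omega
    exact_mod_cast this

/-- The value `f(x, η)` is determined, up to terms of order greater than `q < N ε`, by the
coefficients of `f` with both exponents at most `N`. -/
theorem lt_orderTop_evalSeries_sub_aeval {f : MvPowerSeries (Fin 2) ℂ}
    {p : MvPolynomial (Fin 2) ℂ} {η : RationalSeries} {ε q : ℚ≥0}
    {N : ℕ} (hε : 0 < ε) (hε1 : ε ≤ 1) (hη : (ε : WithTop ℚ≥0) ≤ η.orderTop) (hq : q < N * ε)
    (hf : ∀ m ≤ Finsupp.equivFunOnFinite.symm (fun _ : Fin 2 => N),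
      p.coeff m = MvPowerSeries.coeff m f) :
    (q : WithTop ℚ≥0) < (evalSeries f η - MvPolynomial.aeval ![xPow 1, η] p).orderTop := by
  have h : evalSeries f η - MvPolynomial.aeval ![xPow 1, η] p = evalSeries (f - p) η := by
    rw [← evalSeries_coe p (lt_of_lt_of_le (WithTop.coe_lt_coe.2 hε) hη), sub_eq_iff_eq_add,
      ← evalSeries_add, sub_add_cancel]
  rw [h]
  refine lt_orderTop_evalSeries hε hε1 hη hq fun m hm => ?_
  rw [map_sub, MvPolynomial.coeff_coe, hf m hm, sub_self]

theorem exists_pos_le_of_pos {t : WithTop ℚ≥0} (ht : 0 < t) :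
    ∃ ε : ℚ≥0, 0 < ε ∧ ε ≤ 1 ∧ (ε : WithTop ℚ≥0) ≤ t := by
  cases t with
  | top => exact ⟨1, one_pos, le_rfl, le_top⟩
  | coe a =>
    exact ⟨min a 1, lt_min (WithTop.coe_lt_coe.1 ht) one_pos, min_le_right _ _,
      WithTop.coe_le_coe.2 (min_le_left _ _)⟩

theorem exists_nat_lt_mul {ε : ℚ≥0} (hε : 0 < ε) (q : ℚ≥0) : ∃ N : ℕ, q < N * ε := by
  obtain ⟨N, hN⟩ := exists_nat_gt (q / ε)
  exact ⟨N, (div_lt_iff₀ hε).1 hN⟩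

theorem evalSeries_mul (f g : MvPowerSeries (Fin 2) ℂ) {η : RationalSeries}
    (hη : 0 < η.orderTop) : evalSeries (f * g) η = evalSeries f η * evalSeries g η := by
  obtain ⟨ε, hε, hε1, hεη⟩ := exists_pos_le_of_pos hη
  ext q
  obtain ⟨N, hN⟩ := exists_nat_lt_mul hε q
  let n : Fin 2 →₀ ℕ := Finsupp.equivFunOnFinite.symm fun _ => N
  let φ : MvPolynomial (Fin 2) ℂ →ₐ[ℂ] RationalSeries := MvPolynomial.aeval ![xPow 1, η]
  -- Modulo terms of order greater than `q`, the three series are polynomials.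
  have trunc_apply (h : MvPowerSeries (Fin 2) ℂ) : (q : WithTop ℚ≥0) <
      (evalSeries h η - φ (MvPowerSeries.trunc' ℂ n h)).orderTop :=
    lt_orderTop_evalSeries_sub_aeval hε hε1 hεη hN fun m hm => by
      rw [MvPowerSeries.coeff_trunc', if_pos hm]
  have hfg : (q : WithTop ℚ≥0) < (evalSeries (f * g) η -
      φ (MvPowerSeries.trunc' ℂ n f * MvPowerSeries.trunc' ℂ n g)).orderTop :=
    lt_orderTop_evalSeries_sub_aeval hε hε1 hεη hN fun m hm =>
      MvPowerSeries.coeff_trunc'_mul_trunc'_eq_coeff_mul n f g hm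
  rw [← sub_eq_zero, ← coeff_sub]
  apply coeff_eq_zero_of_lt_orderTop
  have key : evalSeries (f * g) η - evalSeries f η * evalSeries g η =
      (evalSeries (f * g) η - φ (MvPowerSeries.trunc' ℂ n f * MvPowerSeries.trunc' ℂ n g)) +
      (-((evalSeries f η - φ (MvPowerSeries.trunc' ℂ n f)) * evalSeries g η) +
      -(φ (MvPowerSeries.trunc' ℂ n f) * (evalSeries g η - φ (MvPowerSeries.trunc' ℂ n g)))) := by
    rw [map_mul]; ring
  rw [key]
  refine lt_orderTop_add hfg (lt_orderTop_add ?_ ?_)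
  · rw [orderTop_neg, orderTop_mul]
    exact (trunc_apply f).trans_le (le_add_of_nonneg_right zero_le)
  · rw [orderTop_neg, orderTop_mul]
    exact (trunc_apply g).trans_le (le_add_of_nonneg_left zero_le)

theorem evalSeries_C (c : ℂ) {η : RationalSeries} (hη : 0 < η.orderTop) :
    evalSeries (algebraMap ℂ _ c) η = single 0 c := by
  have h := evalSeries_coe (MvPolynomial.C c) hη
  rwa [MvPolynomial.coe_C, MvPolynomial.aeval_C, algebraMap_eq_single] at h

theorem evalSeries_X {η : RationalSeries} (hη : 0 < η.orderTop) :
    evalSeries (MvPowerSeries.X 0) η = xPow 1 := by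
  have h := evalSeries_coe (MvPolynomial.X 0) hη
  rwa [MvPolynomial.coe_X, MvPolynomial.aeval_X] at h

/-! ### Newton–Puiseux series -/

/-- A series is a Newton–Puiseux series if and only if its exponents have a common denominator. -/
theorem mem_newtonPuiseux_iff {η : RationalSeries} : η ∈ newtonPuiseux ↔
    ∃ n : ℕ, 0 < n ∧ ∀ q : ℚ≥0, η.coeff q ≠ 0 → ∃ k : ℕ, q = k * (1 / (n : ℚ≥0)) := by
  have hpos (n : ℕ) (hn : 0 < n) : 0 < (xPow (1 / (n : ℚ≥0))).orderTop := by
    rw [xPow, orderTop_single one_ne_zero]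
    exact WithTop.coe_lt_coe.2 (by positivity)
  have hcoeff (n : ℕ) (hn : 0 < n) (ψ : PowerSeries ℂ) (q : ℚ≥0) :
      (PowerSeries.heval (xPow (1 / (n : ℚ≥0))) ψ).coeff q =
        ∑ᶠ k : ℕ, PowerSeries.coeff k ψ * (single (k * (1 / (n : ℚ≥0))) (1 : ℂ)).coeff q := by
    rw [PowerSeries.coeff_heval]
    refine finsum_congr fun k => ?_
    rw [SummableFamily.coeff_def, SummableFamily.powerSeriesFamily_of_orderTop_pos (hpos n hn),
      HahnSeries.coeff_smul, xPow, single_pow, one_pow, nsmul_eq_mul, smul_eq_mul]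
  constructor
  · rintro ⟨n, hn, ψ, rfl⟩
    refine ⟨n, hn, fun q hq => ?_⟩
    by_contra! hk
    rw [hcoeff n hn] at hq
    refine hq (finsum_eq_zero_of_forall_eq_zero fun k => ?_)
    rw [coeff_single_of_ne (hk k), mul_zero]
  · rintro ⟨n, hn, h⟩
    have hn' : (1 / (n : ℚ≥0)) ≠ 0 := by positivity
    refine ⟨n, hn, PowerSeries.mk fun k => η.coeff (k * (1 / (n : ℚ≥0))), ?_⟩
    ext q
    rw [hcoeff n hn]
    by_cases hk : ∃ k : ℕ, q = k * (1 / (n : ℚ≥0))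
    · obtain ⟨k, rfl⟩ := hk
      rw [finsum_eq_single _ k, PowerSeries.coeff_mk, coeff_single_same, mul_one]
      intro j hj
      rw [coeff_single_of_ne, mul_zero]
      intro hjk
      exact hj (by exact_mod_cast (mul_right_cancel₀ hn' hjk).symm)
    · rw [finsum_eq_zero_of_forall_eq_zero]
      · by_contra hq
        exact hk (h q hq)
      · intro k
        rw [coeff_single_of_ne (fun hq => hk ⟨k, hq⟩), mul_zero]

theorem add_single_mem_newtonPuiseux {ξ : RationalSeries} (hξ : ξ ∈ newtonPuiseux) (β : ℚ≥0)
    (c : ℂ) : ξ + single β c ∈ newtonPuiseux := by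
  rw [mem_newtonPuiseux_iff] at hξ ⊢
  obtain ⟨n, hn, h⟩ := hξ
  have hd : (0 : ℚ≥0) < β.den := by exact_mod_cast β.den_pos
  have hn' : (0 : ℚ≥0) < n := by exact_mod_cast hn
  refine ⟨n * β.den, Nat.mul_pos hn β.den_pos, fun q hq => ?_⟩
  by_cases hqβ : q = β
  · refine ⟨n * β.num, ?_⟩
    conv_lhs => rw [hqβ, ← NNRat.num_div_den β]
    push_cast
    field_simp
  · rw [coeff_add, coeff_single_of_ne hqβ, add_zero] at hq
    obtain ⟨k, rfl⟩ := h q hq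
    refine ⟨k * β.den, ?_⟩
    push_cast
    field_simp

theorem self_mem_closeSeries {ξ : RationalSeries} (hξ : ξ ∈ newtonPuiseux) (α : ℝ≥0∞) :
    ξ ∈ closeSeries ξ α :=
  ⟨hξ, by rw [sub_self, orderX_zero]; exact le_top⟩

theorem orderTop_pos_of_mem_closeSeries {ξ η : RationalSeries} (hξ0 : 0 < ξ.orderTop)
    {α : ℝ≥0∞} (hα : 0 < α) (hη : η ∈ closeSeries ξ α) : 0 < η.orderTop := by
  have := lt_orderTop_add hξ0 (orderX_pos.1 (hα.trans_le hη.2))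
  rwa [add_sub_cancel] at this

/-! ### Generic perturbations -/

/-- If a polynomial `Q` over the ring of series takes at some `h` of order at least `β` a value of
order at most `q`, then `Q(c x ^ β)` has order at most `q` for all but finitely many constants
`c`. -/
theorem finite_setOf_lt_orderTop_eval_single {Q : Polynomial RationalSeries} {h : RationalSeries}
    {β q : ℚ≥0} (hh : (β : WithTop ℚ≥0) ≤ h.orderTop) (hq : (Q.eval h).orderTop ≤ q) :
    {c : ℂ | (q : WithTop ℚ≥0) < (Q.eval (single β c)).orderTop}.Finite := by
  let G : ℕ → RationalSeries := fun j => Q.coeff j * single (j * β) 1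
  -- Some term `Q_j x ^ (j β)` has order at most `q`, since the order of `Q_j h ^ j` is not smaller.
  have hG : ∃ j ∈ Finset.range (Q.natDegree + 1), ∃ r ≤ q, (G j).coeff r ≠ 0 := by
    by_contra! hcon
    refine not_lt_of_ge hq (lt_orderTop_iff.2 fun r hr => ?_)
    rw [Polynomial.eval_eq_sum_range, coeff_sum]
    refine Finset.sum_eq_zero fun j hj => coeff_eq_zero_of_lt_orderTop ?_
    refine (WithTop.coe_le_coe.2 hr).trans_lt ((lt_orderTop_iff.2 (hcon j hj)).trans_le ?_)
    simp only [G]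
    rw [orderTop_mul, orderTop_mul, orderTop_single one_ne_zero]
    gcongr
    exact le_orderTop_pow hh j
  obtain ⟨j, hj, r, hr, hjr⟩ := hG
  -- The coefficient of `x ^ r` in `Q(c x ^ β)` is a nonzero polynomial in `c`.
  let R : Polynomial ℂ :=
    ∑ i ∈ Finset.range (Q.natDegree + 1), Polynomial.monomial i ((G i).coeff r)
  have hR : R ≠ 0 := by
    intro h0
    have h1 := congrArg (fun P => Polynomial.coeff P j) h0
    simp only [R, Polynomial.finsetSum_coeff, Polynomial.coeff_monomial, Polynomial.coeff_zero,
      Finset.sum_ite_eq', if_pos hj] at h1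
    exact hjr h1
  have heval (c : ℂ) : (Q.eval (single β c)).coeff r = R.eval c := by
    rw [Polynomial.eval_eq_sum_range, coeff_sum, Polynomial.eval_finsetSum]
    refine Finset.sum_congr rfl fun i _ => ?_
    rw [Polynomial.eval_monomial, single_pow, nsmul_eq_mul]
    have : single (i * β) (c ^ i) = C (c ^ i) * single (i * β) (1 : ℂ) := by
      rw [C_mul_eq_smul]; ext; simp [coeff_single]
    rw [this, mul_left_comm, C_mul_eq_smul, HahnSeries.coeff_smul, smul_eq_mul, mul_comm]
  refine R.roots.toFinset.finite_toSet.subset fun c hc => ?_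
  simp only [Finset.mem_coe, Multiset.mem_toFinset, Polynomial.mem_roots hR, Polynomial.IsRoot]
  rw [← heval]
  exact lt_orderTop_iff.1 hc r hr

/-- If `ξ` has positive order and `h` has order at least `β > 0`, then for all but finitely
many constants `c` the order of `f(x, ξ + c x ^ β)` is at most the order of `f(x, ξ + h)`. -/
theorem finite_setOf_orderTop_evalSeries_lt (f : MvPowerSeries (Fin 2) ℂ)
    {ξ h : RationalSeries} (hξ : 0 < ξ.orderTop) {β : ℚ≥0} (hβ : 0 < β)
    (hh : (β : WithTop ℚ≥0) ≤ h.orderTop) :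
    {c : ℂ | (evalSeries f (ξ + h)).orderTop <
      (evalSeries f (ξ + single β c)).orderTop}.Finite := by
  by_cases h0 : evalSeries f (ξ + h) = 0
  · simp [h0]
  obtain ⟨q, hq⟩ := WithTop.ne_top_iff_exists.1 (orderTop_ne_top.2 h0)
  obtain ⟨ε, hε, hε1, hεξ⟩ := exists_pos_le_of_pos
    (lt_min hξ (WithTop.coe_lt_coe.2 hβ : ((0 : ℚ≥0) : WithTop ℚ≥0) < β))
  obtain ⟨N, hN⟩ := exists_nat_lt_mul hε q
  have hball {k : RationalSeries} (hk : (β : WithTop ℚ≥0) ≤ k.orderTop) :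
      (ε : WithTop ℚ≥0) ≤ (ξ + k).orderTop :=
    (hεξ.trans (min_le_min_left _ hk)).trans min_orderTop_le_orderTop_add
  -- A polynomial whose values at the series considered agree with those of `f` up to order `q`.
  let p := MvPowerSeries.trunc' ℂ (Finsupp.equivFunOnFinite.symm fun _ : Fin 2 => N) f
  have hp {k : RationalSeries} (hk : (β : WithTop ℚ≥0) ≤ k.orderTop) : (q : WithTop ℚ≥0) <
      (evalSeries f (ξ + k) - MvPolynomial.aeval ![xPow 1, ξ + k] p).orderTop :=
    lt_orderTop_evalSeries_sub_aeval hε hε1 (hball hk) hN fun m hm => by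
      rw [MvPowerSeries.coeff_trunc', if_pos hm]
  let Q := Polynomial.taylor ξ
    (MvPolynomial.aeval ![Polynomial.C (xPow 1), Polynomial.X] p : Polynomial RationalSeries)
  have hQ (k : RationalSeries) : Q.eval k = MvPolynomial.aeval ![xPow 1, ξ + k] p := by
    rw [Polynomial.taylor_eval, add_comm k ξ, ← Polynomial.coe_aeval_eq_eval]
    refine (MvPolynomial.comp_aeval_apply _
      ((Polynomial.aeval (R := RationalSeries) (ξ + k)).restrictScalars ℂ) p).trans ?_
    congr 2
    ext1 i
    fin_cases i <;> simp
  have hQh : (Q.eval h).orderTop ≤ q := by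
    rw [hQ]
    by_contra! hlt
    have := lt_orderTop_add (hp hh) hlt
    rw [sub_add_cancel, ← hq] at this
    exact lt_irrefl _ this
  refine (finite_setOf_lt_orderTop_eval_single hh hQh).subset fun c hc => ?_
  rw [Set.mem_ofPred_eq, ← hq] at hc
  rw [Set.mem_ofPred_eq, hQ]
  have hpc := hp (orderTop_single_le (a := β) (r := c))
  rw [← orderTop_neg] at hpc
  have := lt_orderTop_add hc hpc
  rwa [neg_sub, add_sub_cancel] at this

/-- The orders of `f(x, η)` and `g(x, η)` at two members of the ball `ν_x(η - ξ) ≥ α` are attained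
or improved simultaneously at a single member. -/
theorem exists_mem_closeSeries_orderX_le (f g : MvPowerSeries (Fin 2) ℂ) {ξ : RationalSeries}
    (hξ : ξ ∈ newtonPuiseux) (hξ0 : 0 < ξ.orderTop) {α : ℝ≥0∞} (hα : 0 < α)
    {η₁ η₂ : RationalSeries} (h₁ : η₁ ∈ closeSeries ξ α) (h₂ : η₂ ∈ closeSeries ξ α) :
    ∃ η ∈ closeSeries ξ α, orderX (evalSeries f η) ≤ orderX (evalSeries f η₁) ∧
      orderX (evalSeries g η) ≤ orderX (evalSeries g η₂) := by
  by_cases htop : min (η₁ - ξ).orderTop (η₂ - ξ).orderTop = ⊤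
  · rw [min_eq_top, orderTop_eq_top, orderTop_eq_top, sub_eq_zero, sub_eq_zero] at htop
    exact ⟨η₁, h₁, le_rfl, by rw [htop.1, htop.2]⟩
  obtain ⟨β, hβ⟩ := WithTop.ne_top_iff_exists.1 htop
  have hβ₁ : (β : WithTop ℚ≥0) ≤ (η₁ - ξ).orderTop := hβ.trans_le (min_le_left _ _)
  have hβ₂ : (β : WithTop ℚ≥0) ≤ (η₂ - ξ).orderTop := hβ.trans_le (min_le_right _ _)
  have hβ0 : 0 < β := by
    rw [← WithTop.coe_lt_coe, hβ]
    exact lt_min (orderX_pos.1 (hα.trans_le h₁.2)) (orderX_pos.1 (hα.trans_le h₂.2))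
  obtain ⟨c, hc⟩ := ((finite_setOf_orderTop_evalSeries_lt f hξ0 hβ0 hβ₁).union
    (finite_setOf_orderTop_evalSeries_lt g hξ0 hβ0 hβ₂)).infinite_compl.nonempty
  simp only [Set.mem_compl_iff, Set.mem_union, Set.mem_ofPred_eq, not_or, not_lt,
    add_sub_cancel] at hc
  refine ⟨ξ + single β c, ⟨add_single_mem_newtonPuiseux hξ β c, ?_⟩,
    orderX_le_orderX.2 hc.1, orderX_le_orderX.2 hc.2⟩
  rw [add_sub_cancel_left]
  have hle : min (η₁ - ξ).orderTop (η₂ - ξ).orderTop ≤ (single β c).orderTop :=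
    hβ.symm.trans_le orderTop_single_le
  rcases min_le_iff.1 hle with h | h
  · exact h₁.2.trans (orderX_le_orderX.2 h)
  · exact h₂.2.trans (orderX_le_orderX.2 h)

/-! ### The two families of semivaluations -/

/-- The restriction `f(0, y)` of a series to the branch `Z(x)`. -/
noncomputable def restrict (f : MvPowerSeries (Fin 2) ℂ) : PowerSeries ℂ :=
  PowerSeries.mk fun j => MvPowerSeries.coeff (Finsupp.single 1 j) f

theorem restrict_mul (f g : MvPowerSeries (Fin 2) ℂ) :
    restrict (f * g) = restrict f * restrict g := by
  ext j
  classical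
  simp only [restrict, PowerSeries.coeff_mk, PowerSeries.coeff_mul, MvPowerSeries.coeff_mul,
    Finsupp.antidiagonal_single, Finset.sum_map]
  rfl

theorem X_dvd_iff_restrict_eq_zero (f : MvPowerSeries (Fin 2) ℂ) :
    MvPowerSeries.X 0 ∣ f ↔ restrict f = 0 := by
  rw [MvPowerSeries.X_dvd_iff, PowerSeries.ext_iff]
  simp only [restrict, PowerSeries.coeff_mk, map_zero]
  refine ⟨fun h j => h _ (by simp), fun h m hm => ?_⟩
  have hm' : m = Finsupp.single 1 (m 1) := by
    ext i
    fin_cases i <;> simp [hm]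
  rw [hm']
  exact h _

theorem prime_X : Prime (MvPowerSeries.X 0 : MvPowerSeries (Fin 2) ℂ) := by
  refine ⟨fun h => ?_, fun h => ?_, fun f g h => ?_⟩
  · have := congrArg (MvPowerSeries.coeff (Finsupp.single 0 1)) h
    rw [MvPowerSeries.coeff_index_single_self_X, map_zero] at this
    exact one_ne_zero this
  · rw [MvPowerSeries.isUnit_iff_constantCoeff, MvPowerSeries.constantCoeff_X] at h
    exact not_isUnit_zero h
  · simpa only [X_dvd_iff_restrict_eq_zero, restrict_mul, mul_eq_zero] using h

theorem isSemivaluation_vanishingOrder_and_self {O : Type*} [CommRing O] [Algebra ℂ O]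
    (c : LocalCoordinates O) :
    IsSemivaluation (vanishingOrder c.x) ∧ vanishingOrder c.x c.x = 1 := by
  have heq (f : O) : emultiplicity c.x f = emultiplicity (MvPowerSeries.X 0) (c.iso f) := by
    rw [← c.iso_x, emultiplicity_map_eq]
  refine ⟨⟨fun f g => ?_, fun f g => ?_, fun a ha => ?_, ?_⟩, ?_⟩
  · simp only [vanishingOrder, heq, map_mul, emultiplicity_mul prime_X, ENat.toENNReal_add]
  · simp only [vanishingOrder]
    rw [← ENat.toENNReal_min, ENat.toENNReal_le]
    exact min_le_emultiplicity_add
  · rw [vanishingOrder, heq, emultiplicity_of_isUnit_right prime_X.not_isUnit, ENat.toENNReal_zero]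
    exact ((isUnit_iff_ne_zero.2 ha).map (algebraMap ℂ O)).map c.iso
  · simp [vanishingOrder]
  · rw [vanishingOrder, heq, c.iso_x]
    have h := emultiplicity_pow_self_of_prime prime_X 1
    rw [pow_one] at h
    simp [h]

theorem isSemivaluation_iInf_orderX {O : Type*} [CommRing O] [Algebra ℂ O]
    (c : LocalCoordinates O) {ξ : RationalSeries} (hξ : ξ ∈ newtonPuiseux)
    (hξ0 : 0 < ξ.orderTop) {α : ℝ≥0∞} (hα : 0 < α) :
    IsSemivaluation (fun f => ⨅ η ∈ closeSeries ξ α, orderX (evalSeries (c.iso f) η)) := by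
  have hpos {η : RationalSeries} (hη : η ∈ closeSeries ξ α) : 0 < η.orderTop :=
    orderTop_pos_of_mem_closeSeries hξ0 hα hη
  refine ⟨fun f g => le_antisymm ?_ ?_, fun f g => ?_, fun a ha => ?_, ?_⟩
  · -- The infimum of sums is the sum of infima, since the ball is directed for both orders at once.
    simp only [iInf_subtype']
    refine ENNReal.le_iInf_add_iInf fun η₁ η₂ => ?_
    obtain ⟨η, hη, hf, hg⟩ := exists_mem_closeSeries_orderX_le (c.iso f) (c.iso g) hξ hξ0 hα
      η₁.2 η₂.2
    refine (iInf_le _ ⟨η, hη⟩).trans ?_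
    rw [map_mul, evalSeries_mul _ _ (hpos hη), orderX_mul]
    exact add_le_add hf hg
  · refine le_iInf₂ fun η hη => ?_
    rw [map_mul, evalSeries_mul _ _ (hpos hη), orderX_mul]
    exact add_le_add (iInf₂_le η hη) (iInf₂_le η hη)
  · refine le_iInf₂ fun η hη => ?_
    rw [map_add, evalSeries_add]
    exact (min_le_min (iInf₂_le η hη) (iInf₂_le η hη)).trans (min_orderX_le_orderX_add _ _)
  · refine nonpos_iff_eq_zero.1 ((iInf₂_le ξ (self_mem_closeSeries hξ α)).trans ?_)
    rw [AlgEquiv.commutes, evalSeries_C a hξ0, orderX_single ha]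
    simp
  · refine iInf₂_eq_top.2 fun η hη => ?_
    rw [map_zero, ← map_zero (algebraMap ℂ _), evalSeries_C 0 (hpos hη), single_eq_zero,
      orderX_zero]

end NewtonPuiseuxSemivaluation

open NewtonPuiseuxSemivaluation in
theorem proposition7p5 {O : Type*} [CommRing O] [Algebra ℂ O]
    (c : NewtonPuiseuxSemivaluation.LocalCoordinates O)
    (ξ : NewtonPuiseuxSemivaluation.RationalSeries)
    (hξ : ξ ∈ NewtonPuiseuxSemivaluation.newtonPuiseux)
    (α : ℝ≥0∞)
    (hξα : 0 < α → 0 < NewtonPuiseuxSemivaluation.orderX ξ) :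
    NewtonPuiseuxSemivaluation.nu c ξ α ∈
      NewtonPuiseuxSemivaluation.normalizedSemivaluations c.x := by
  by_cases hα : α = 0
  · have h : nu c ξ α = vanishingOrder c.x := funext fun f => if_pos hα
    rw [h]
    exact isSemivaluation_vanishingOrder_and_self c
  have hα0 : 0 < α := pos_iff_ne_zero.2 hα
  have hξ0 : 0 < ξ.orderTop := orderX_pos.1 (hξα hα0)
  have h : nu c ξ α = fun f => ⨅ η ∈ closeSeries ξ α, orderX (evalSeries (c.iso f) η) :=
    funext fun f => if_neg hα
  rw [h]
  refine ⟨isSemivaluation_iInf_orderX c hξ hξ0 hα0, ?_⟩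
  have hx {η : RationalSeries} (hη : η ∈ closeSeries ξ α) :
      orderX (evalSeries (c.iso c.x) η) = 1 := by
    rw [c.iso_x, evalSeries_X (orderTop_pos_of_mem_closeSeries hξ0 hα0 hη), xPow,
      orderX_single one_ne_zero]
    simp
  have hself := self_mem_closeSeries hξ α
  exact le_antisymm ((iInf₂_le ξ hself).trans_eq (hx hself)) (le_iInf₂ fun η hη => (hx hη).ge)
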